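/- All graphs are finite, undirected, without loops or multiple edges. $P_r$ is the path on $r$ vertices, $G+H$ is the disjoint union of $G$ and $H$, $rG$ is the disjoint union of $r$ copies of $G$, and $\overline{G}$ is the complement of $G$. A graph $G$ is self-complementary if $G\cong\overline{G}$, and the bull is the graph obtained from a triangle by attaching one pendant vertex to each of two of its vertices. For a set ${\cal H}$ of graphs, a graph is ${\cal H}$-free if none of its induced subgraphs is isomorphic to a graph in ${\cal H}$. The clique-width of a graph is the minimum number of labels needed to construct it by the operations: creating a single vertex with label $i$; disjoint union of two labelled graphs; joining every vertex with label $i$ to every vertex with label $j$ ($i\neq j$); renaming label $i$ to $j$. (The graph without vertices has clique-width $0$.) A class of graphs has unbounded clique-width if no constant bounds the clique-width of all its members. For $h\ge 1$, the wall of height $h$ has as vertices the points $(x,y)$ with $0\le x\le 2h+1$, $0\le y\le h$, except $(0,0)$ and except $(0,h)$ if $h$ is odd, $(2h+1,h)$ if $h$ is even; its edges are the horizontal edges between $(x,y)$ and $(x+1,y)$ and the vertical edges between $(x,y)$ and $(x,y+1)$ with $x+y$ odd. Let $W_h$ be obtained from the wall of height $h$ by subdividing every edge exactly once and then complementing the subgraph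 induced by each of the following three independent sets (so that each becomes a clique): the original vertices of the wall, the vertices subdividing vertical edges, and the vertices subdividing horizontal edges. **Theorem.** Let ${\cal F}$ be the set of all self-complementary graphs on at least five vertices that are not isomorphic to the bull. Then the class of $(\{4P_1,\overline{3P_1+P_2}\}\cup{\cal F})$-free graphs has unbounded clique-width. Moreover, every $W_h$ with $h\geq 1$ is $(\{4P_1,\overline{3P_1+P_2}\}\cup{\cal F})$-free, and the class $\{W_h : h\ge 1\}$ has unbounded clique-width. -/

import Mathlib

namespace CliqueWidth

open SimpleGraph

/-! ### Clique-width -/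

/-- Expressions over the label set `Fin k`, built from the four operations that define
clique-width. -/
inductive Expr (k : ℕ) : Type
  /-- a single vertex with label `i` -/
  | vertex (i : Fin k) : Expr k
  /-- disjoint union of two labelled graphs -/
  | union (s t : Expr k) : Expr k
  /-- join each vertex with label `i` to each vertex with label `j`, where `i ≠ j` -/
  | join (i j : Fin k) (hij : i ≠ j) (t : Expr k) : Expr k
  /-- rename label `i` to `j` -/
  | rename (i j : Fin k) (t : Expr k) : Expr k

namespace Expr

/-- The vertex set of the labelled graph constructed by an expression. -/
@[reducible] def Vert {k : ℕ} : Expr k → Type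
  | vertex _ => Unit
  | union s t => s.Vert ⊕ t.Vert
  | join _ _ _ t => t.Vert
  | rename _ _ t => t.Vert

/-- The labels of the labelled graph constructed by an expression. -/
def label {k : ℕ} : (t : Expr k) → t.Vert → Fin k
  | vertex i => fun _ => i
  | union s t => Sum.elim s.label t.label
  | join _ _ _ t => t.label
  | rename i j t => fun v => if t.label v = i then j else t.label v

/-- The underlying graph of the labelled graph constructed by an expression. -/
def graph {k : ℕ} : (t : Expr k) → SimpleGraph t.Vert
  | vertex _ => (⊥ : SimpleGraph Unit)
  | union s t => s.graph ⊕g t.graph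
  | join i j _ t => t.graph ⊔ SimpleGraph.fromRel (fun u v => t.label u = i ∧ t.label v = j)
  | rename _ _ t => t.graph

end Expr

/-- `G` can be constructed, up to isomorphism, with the labels in `Fin k`. -/
def Constructible {V : Type} (G : SimpleGraph V) (k : ℕ) : Prop :=
  ∃ t : Expr k, Nonempty (t.graph ≃g G)

/-- The clique-width: the minimum number of labels needed to construct `G`. Every finite graph
with a vertex is constructible with some number of labels; the graph without vertices is
given clique-width `0`. -/
noncomputable def cliqueWidth {V : Type} (G : SimpleGraph V) : ℕ :=
  sInf {k : ℕ | Constructible G k}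

/-! ### Classes of finite graphs -/

/-- A finite simple graph. -/
structure FinGraph where
  /-- the vertex set -/
  V : Type
  /-- the vertex set is finite -/
  finite : Finite V
  /-- the graph -/
  graph : SimpleGraph V

/-- A class of graphs has bounded clique-width if some constant bounds the clique-width of all
its members. -/
def HasBoundedCliqueWidth (𝒢 : Set FinGraph) : Prop :=
  ∃ c : ℕ, ∀ G ∈ 𝒢, cliqueWidth G.graph ≤ c

/-- A class of graphs has unbounded clique-width if it does not have bounded clique-width. -/
def HasUnboundedCliqueWidth (𝒢 : Set FinGraph) : Prop :=
  ¬ HasBoundedCliqueWidth 𝒢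

/-- The class of `ℋ`-free graphs: no induced subgraph is isomorphic to a graph in `ℋ`. -/
def freeGraphs (ℋ : Set FinGraph) : Set FinGraph :=
  {G | ∀ H ∈ ℋ, ¬ H.graph.IsIndContained G.graph}

/-- The graph `4P₁`: four isolated vertices. -/
def fourP1 : FinGraph :=
  ⟨Fin 4, inferInstance, ⊥⟩

/-- The complement of `3P₁ + P₂`. -/
def coThreeP1AddP2 : FinGraph :=
  ⟨Fin 3 ⊕ Fin 2, inferInstance, ((⊥ : SimpleGraph (Fin 3)) ⊕g pathGraph 2)ᶜ⟩

/-- The bull: a triangle `1, 2, 3` with pendant vertices `0` at `1` and `4` at `3`. -/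
def bull : SimpleGraph (Fin 5) :=
  SimpleGraph.fromEdgeSet {s(0, 1), s(1, 2), s(2, 3), s(3, 4), s(1, 3)}

/-- A graph is self-complementary if it is isomorphic to its complement. -/
def IsSelfComplementary {V : Type} (G : SimpleGraph V) : Prop :=
  Nonempty (G ≃g Gᶜ)

/-- All self-complementary graphs on at least five vertices that are not the bull. -/
def selfComplementaryNonBull : Set FinGraph :=
  {H | IsSelfComplementary H.graph ∧ 5 ≤ Nat.card H.V ∧ IsEmpty (H.graph ≃g bull)}

/-! ### Walls, their subdivisions, and complementation on a vertex set -/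

/-- The vertices of the wall of height `h`: the points `(x, y)` with `0 ≤ x ≤ 2h + 1` and
`0 ≤ y ≤ h`, except for the two corners that would have degree one, namely `(0, 0)` and, in the
top row, `(0, h)` if `h` is odd and `(2h + 1, h)` if `h` is even. -/
def WallVert (h : ℕ) : Type :=
  {p : Fin (2 * h + 2) × Fin (h + 1) //
    ¬ (p.1.val = 0 ∧ p.2.val = 0) ∧
    ¬ (p.1.val = (if Odd h then 0 else 2 * h + 1) ∧ p.2.val = h)}

/-- The column of a vertex of a wall. -/
def WallVert.x {h : ℕ} (p : WallVert h) : ℕ := p.1.1.val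

/-- The row of a vertex of a wall. -/
def WallVert.y {h : ℕ} (p : WallVert h) : ℕ := p.1.2.val

/-- The wall of height `h`: consecutive points of a row are adjacent, and `(x, y)` is adjacent to
`(x, y + 1)` if `x + y` is odd. -/
def wall (h : ℕ) : SimpleGraph (WallVert h) :=
  SimpleGraph.fromRel (fun p q =>
    (p.y = q.y ∧ q.x = p.x + 1) ∨ (p.x = q.x ∧ q.y = p.y + 1 ∧ Odd (p.x + p.y)))

/-- The graph obtained from `G` by subdividing every edge exactly once: the new vertices are the
edges of `G`, each adjacent to its two ends. -/
def subdivide {V : Type} (G : SimpleGraph V) : SimpleGraph (V ⊕ G.edgeSet) :=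
  SimpleGraph.fromRel (fun a b => ∃ (v : V) (e : G.edgeSet), a = Sum.inl v ∧ b = Sum.inr e ∧
    v ∈ e.val)

/-- Subgraph complementation on the vertex set `S`: edges inside `S` become non-edges and vice
versa. -/
def complementOn {V : Type} (G : SimpleGraph V) (S : Set V) : SimpleGraph V where
  Adj u v := u ≠ v ∧ ((u ∈ S ∧ v ∈ S ∧ ¬ G.Adj u v) ∨ (¬ (u ∈ S ∧ v ∈ S) ∧ G.Adj u v))
  symm := ⟨fun u v h => by
    have := G.adj_comm u v
    tauto⟩
  loopless := ⟨fun _ h => h.1 rfl⟩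

/-- The vertices of the subdivided wall that are vertices of the wall. -/
def wallV1 (h : ℕ) : Set (WallVert h ⊕ (wall h).edgeSet) :=
  Set.range Sum.inl

/-- The vertices of the subdivided wall that subdivide vertical edges. -/
def wallV2 (h : ℕ) : Set (WallVert h ⊕ (wall h).edgeSet) :=
  Sum.inr '' {e | ∀ p ∈ e.val, ∀ q ∈ e.val, p.x = q.x}

/-- The vertices of the subdivided wall that subdivide horizontal edges. -/
def wallV3 (h : ℕ) : Set (WallVert h ⊕ (wall h).edgeSet) :=
  Sum.inr '' {e | ∀ p ∈ e.val, ∀ q ∈ e.val, p.y = q.y}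

instance (h : ℕ) : Finite (WallVert h) := by
  unfold WallVert
  infer_instance

/-- The 1-subdivided wall of height `h` after complementing on each of its three natural
independent sets. -/
def complementedWall (h : ℕ) : FinGraph :=
  ⟨WallVert h ⊕ (wall h).edgeSet, inferInstance,
    complementOn (complementOn (complementOn (subdivide (wall h)) (wallV1 h)) (wallV2 h))
      (wallV3 h)⟩

end CliqueWidth

/-!
Consider, in a construction of a graph with `k` labels, the vertices built so far at some stage: the
same label means the same neighbours among the vertices that come later, so at most `k` induced
matching edges lead out of such a set. Take rows and columns of the wall with their subdivision
vertices, and consider the first stage at which a whole row is complete. Each of the two parts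
joined last contains no complete row. So either every row is split by that stage or by the first of
the two parts, or some row is disjoint from the stage and every column is split by it. By
connectedness each split row or column contains a wall vertex and an incident subdivision vertex on
different sides; incidences are untouched by the complementations, so these edges form induced
matchings and the height of the wall is at most linear in `k`.

For freeness, `W_h` is partitioned into three cliques, which excludes `4P₁`, and two of the cliques
(the two kinds of subdivision vertices) have no edges between them. The common neighbourhood of two
nonadjacent vertices contains no triangle, since at most two edges of the same direction meet at a
vertex of the wall. An isomorphism `σ` from an induced subgraph to its complement turns each clique
into an independent set, which has at most three vertices, and comparing the images of the
two nonadjacent cliques shows that there are at most seven vertices in total. As the number of pairs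
of vertices is even, there are exactly five if there are at least five. The cycles of `σ` then have
length `1` or `4`, so the subgraph is the bull or `C₅`, and `C₅` has no such clique partition.
-/

namespace CliqueWidth

open SimpleGraph

/-! ### Vertex sets with few outer types -/

section OuterTypes

variable {V : Type*} {G : SimpleGraph V} {k : ℕ}

/-- The vertices of `A` have at most `k` types, where vertices of the same type have the same
neighbours outside `A`. -/
def OuterTypesLE (G : SimpleGraph V) (A : Set V) (k : ℕ) : Prop :=
  ∃ type : A → Fin k, ∀ u v : A, type u = type v → ∀ w ∉ A, G.Adj u w → G.Adj v w

lemma OuterTypesLE.card_le_of_induced_matching {A : Set V} (hA : OuterTypesLE G A k)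
    {ι : Type*} {u w : ι → V} (hu : ∀ i, u i ∈ A) (hw : ∀ i, w i ∉ A)
    (hadj : ∀ i, G.Adj (u i) (w i)) (hind : ∀ i j, G.Adj (u i) (w j) → i = j) :
    Nat.card ι ≤ k := by
  obtain ⟨type, htype⟩ := hA
  have inj : Function.Injective fun i => type ⟨u i, hu i⟩ := fun i j hij =>
    (hind j i (htype _ _ hij _ (hw i) (hadj i))).symm
  simpa using Nat.card_le_card_of_injective _ inj

/-- The labelled graph of the expression `t` occurs along `f` at some stage of a construction of
`G`: all later edges among its vertices depend on their labels only, and vertices with the same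
label have the same neighbours among the vertices that are added later. -/
structure Expr.IsStage (G : SimpleGraph V) (t : Expr k) (f : t.Vert ↪ V) : Prop where
  exists_adj_iff : ∃ R : Fin k → Fin k → Prop, ∀ x y, x ≠ y →
    (G.Adj (f x) (f y) ↔ t.graph.Adj x y ∨ R (t.label x) (t.label y))
  adj_of_label_eq : ∀ x y, t.label x = t.label y → ∀ w ∉ Set.range f,
    G.Adj (f x) w → G.Adj (f y) w

namespace Expr.IsStage

variable {s t : Expr k}

lemma outerTypesLE {f : t.Vert ↪ V} (h : t.IsStage G f) : OuterTypesLE G (Set.range f) k := by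
  refine ⟨t.label ∘ (Equiv.ofInjective f f.injective).symm, ?_⟩
  rintro ⟨_, x, rfl⟩ ⟨_, y, rfl⟩ hxy
  exact h.adj_of_label_eq x y (by simpa using hxy)

lemma of_component {f : t.Vert ↪ V} (h : t.IsStage G f) (g : s.graph ↪g t.graph)
    (hlabel : ∀ x, t.label (g x) = s.label x)
    (hcomponent : ∀ x, ∀ z ∉ Set.range g, ¬ t.graph.Adj (g x) z) :
    s.IsStage G (g.toEmbedding.trans f) := by
  obtain ⟨⟨R, hR⟩, hout⟩ := h
  refine ⟨⟨R, fun x y hxy => ?_⟩, fun x y hxy w hw hxw => ?_⟩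
  · simpa [hlabel] using hR (g x) (g y) (g.injective.ne hxy)
  by_cases hwf : w ∈ Set.range f
  · obtain ⟨z, rfl⟩ := hwf
    have hz : z ∉ Set.range g := fun ⟨y, hy⟩ => hw ⟨y, congrArg f hy⟩
    have hne (v : s.Vert) : g v ≠ z := fun hv => hz ⟨v, hv⟩
    have hRxz := ((hR (g x) z (hne x)).1 hxw).resolve_left (hcomponent x z hz)
    exact (hR (g y) z (hne y)).2 (.inr (by rwa [hlabel, ← hxy, ← hlabel]))
  · exact hout (g x) (g y) (by simpa only [hlabel] using hxy) w hwf hxw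

lemma union_left {f : (union s t).Vert ↪ V} (h : (union s t).IsStage G f) :
    s.IsStage G (Function.Embedding.inl.trans f) :=
  h.of_component (Embedding.sumInl (H := t.graph)) (fun _ => rfl) fun x z hz => by
    rcases z with z | z
    · exact absurd ⟨z, rfl⟩ hz
    · simp [graph, Embedding.sumInl]

lemma union_right {f : (union s t).Vert ↪ V} (h : (union s t).IsStage G f) :
    t.IsStage G (Function.Embedding.inr.trans f) :=
  h.of_component (Embedding.sumInr (G := s.graph)) (fun _ => rfl) fun x z hz => by
    rcases z with z | z
    · simp [graph, Embedding.sumInr]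
    · exact absurd ⟨z, rfl⟩ hz

lemma of_join {i j : Fin k} {hij : i ≠ j} {f : (join i j hij t).Vert ↪ V}
    (h : (join i j hij t).IsStage G f) : t.IsStage G f := by
  obtain ⟨⟨R, hR⟩, hout⟩ := h
  refine ⟨⟨fun a b => R a b ∨ (a = i ∧ b = j) ∨ (b = i ∧ a = j), fun x y hxy => ?_⟩, hout⟩
  rw [hR x y hxy]
  simp only [graph, label, sup_adj, fromRel_adj]
  tauto

lemma of_rename {i j : Fin k} {f : (rename i j t).Vert ↪ V}
    (h : (rename i j t).IsStage G f) : t.IsStage G f := by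
  obtain ⟨⟨R, hR⟩, hout⟩ := h
  exact ⟨⟨fun a b => R (if a = i then j else a) (if b = i then j else b), hR⟩,
    fun x y hxy => hout x y (by simp [label, hxy])⟩

lemma exists_outerTypesLE_union {f : t.Vert ↪ V} (h : t.IsStage G f) {Q : Set V → Prop}
    (hsingleton : ∀ v, ¬ Q {v}) (hQ : Q (Set.range f)) :
    ∃ A B : Set V, OuterTypesLE G A k ∧ OuterTypesLE G (A ∪ B) k ∧ Q (A ∪ B) ∧ ¬ Q A ∧ ¬ Q B := by
  induction t with
  | vertex i =>
    rw [Set.range_unique] at hQ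
    exact absurd hQ (hsingleton _)
  | union s t ihs iht =>
    by_cases hs : Q (Set.range (Function.Embedding.inl.trans f))
    · exact ihs h.union_left hs
    by_cases ht : Q (Set.range (Function.Embedding.inr.trans f))
    · exact iht h.union_right ht
    have hrange : Set.range (Function.Embedding.inl.trans f) ∪
        Set.range (Function.Embedding.inr.trans f) = Set.range f := by
      ext v; simp
    exact ⟨_, _, h.union_left.outerTypesLE, hrange ▸ h.outerTypesLE, hrange ▸ hQ, hs, ht⟩
  | join i j hij t ih => exact ih h.of_join hQ
  | rename i j t ih => exact ih h.of_rename hQ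

end Expr.IsStage

end OuterTypes

/-- Walking up a construction of `G` until `Q` holds for the first time. -/
lemma Constructible.exists_outerTypesLE_union {V : Type} {G : SimpleGraph V} {k : ℕ}
    (hG : Constructible G k) {Q : Set V → Prop} (hsingleton : ∀ v, ¬ Q {v}) (hQ : Q Set.univ) :
    ∃ A B : Set V, OuterTypesLE G A k ∧ OuterTypesLE G (A ∪ B) k ∧ Q (A ∪ B) ∧ ¬ Q A ∧ ¬ Q B := by
  obtain ⟨t, ⟨e⟩⟩ := hG
  have hrange : Set.range e.toEmbedding.toEmbedding = Set.univ := e.surjective.range_eq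
  have hstage : t.IsStage G e.toEmbedding.toEmbedding :=
    ⟨⟨fun _ _ => False, fun x y _ => by simpa using e.map_adj_iff⟩,
      fun _ _ _ w hw => absurd (hrange ▸ Set.mem_univ w) hw⟩
  exact hstage.exists_outerTypesLE_union hsingleton (hrange ▸ hQ)

/-! ### Finite graphs are constructible -/

namespace Expr

variable {n : ℕ}

lemma exists_graph_eq_bot {S : Finset (Fin n)} (hS : S.Nonempty) :
    ∃ t : Expr n, Function.Injective t.label ∧ Set.range t.label = S ∧ t.graph = ⊥ := by
  induction hS using Finset.Nonempty.cons_induction with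
  | singleton a => exact ⟨vertex a, fun _ _ _ => rfl, by simp [label], rfl⟩
  | cons a S ha _ ih =>
    obtain ⟨t, hinj, hrange, hgraph⟩ := ih
    have hlabel : ∀ v, t.label v ≠ a := fun v hv => ha (by
      rw [← Finset.mem_coe, ← hrange, ← hv]
      exact Set.mem_range_self v)
    refine ⟨union (vertex a) t, ?_, ?_, ?_⟩
    · exact Function.Injective.sumElim (fun _ _ _ => rfl) hinj fun _ v => (hlabel v).symm
    · simp [label, hrange]
    · ext (u | u) (v | v) <;> simp [graph, hgraph]

lemma exists_graph_eq_comap_fromRel (hn : 0 < n) (E : Finset (Fin n × Fin n)) :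
    ∃ t : Expr n, Function.Bijective t.label ∧
      t.graph = (fromRel fun i j => (i, j) ∈ E).comap t.label := by
  induction E using Finset.induction_on with
  | empty =>
    obtain ⟨t, hinj, hrange, hgraph⟩ :=
      exists_graph_eq_bot (S := (Finset.univ : Finset (Fin n))) ⟨⟨0, hn⟩, Finset.mem_univ _⟩
    refine ⟨t, ⟨hinj, Set.range_eq_univ.1 (by simpa using hrange)⟩, ?_⟩
    ext u v
    simp [hgraph]
  | insert p E _ ih =>
    obtain ⟨t, hbij, hgraph⟩ := ih
    obtain ⟨i, j⟩ := p
    by_cases hij : i = j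
    · refine ⟨t, hbij, ?_⟩
      ext u v
      simp only [hgraph, comap_adj, fromRel_adj, Finset.mem_insert, Prod.mk.injEq]
      grind
    · refine ⟨join i j hij t, hbij, ?_⟩
      ext u v
      simp only [graph, label, hgraph, sup_adj, comap_adj, fromRel_adj, Finset.mem_insert,
        Prod.mk.injEq, hbij.1.ne_iff]
      tauto

end Expr

lemma Constructible.pos {V : Type} [Nonempty V] {G : SimpleGraph V} {k : ℕ}
    (hG : Constructible G k) : 0 < k := by
  obtain ⟨t, ⟨e⟩⟩ := hG
  exact (t.label (e.symm (Classical.arbitrary V))).pos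

lemma constructible_fin {n : ℕ} (hn : 0 < n) (G : SimpleGraph (Fin n)) : Constructible G n := by
  classical
  obtain ⟨t, hbij, hgraph⟩ := Expr.exists_graph_eq_comap_fromRel hn {p | G.Adj p.1 p.2}
  refine ⟨t, ⟨Equiv.ofBijective _ hbij, fun {u v} => ?_⟩⟩
  simpa [hgraph, G.adj_comm (t.label v)] using fun h : G.Adj (t.label u) (t.label v) => h.ne

lemma constructible_card {V : Type} [Finite V] [Nonempty V] (G : SimpleGraph V) :
    Constructible G (Nat.card V) := by
  obtain ⟨t, ⟨e⟩⟩ := constructible_fin Nat.card_pos (G.comap (Finite.equivFin V).symm)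
  exact ⟨t, ⟨e.trans (Iso.comap (Finite.equivFin V).symm G)⟩⟩

lemma constructible_cliqueWidth {V : Type} [Finite V] [Nonempty V] (G : SimpleGraph V) :
    Constructible G (cliqueWidth G) :=
  Nat.sInf_mem (s := {k | Constructible G k}) ⟨_, constructible_card G⟩

/-! ### Grids in subdivided graphs -/

section Grid

/-- Both `A` and its complement meet `S`. -/
def Splits {α : Type*} (A S : Set α) : Prop := (S ∩ A).Nonempty ∧ (S \ A).Nonempty

lemma disjoint_union_of_not_splits {α : Type*} {A B S : Set α} (hA : ¬ Splits A S)
    (hAB : ¬ Splits (A ∪ B) S) (hSA : ¬ S ⊆ A) (hSB : ¬ S ⊆ B) : Disjoint S (A ∪ B) := by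
  simp only [Splits, not_and, Set.not_nonempty_iff_eq_empty, Set.sdiff_eq_empty] at hA hAB
  refine Set.disjoint_left.2 fun v hv hvAB => hSB fun w hw => ?_
  exact (hAB ⟨v, hv, hvAB⟩ hw).resolve_left fun hwA => hSA (hA ⟨w, hw, hwA⟩)

variable {W : Type*} {Γ : SimpleGraph W}

/-- The vertices over `S` in a graph obtained by subdividing the edges of `Γ`: the vertices in `S`
and the edges with both ends in `S`. -/
def subdivisionPart (Γ : SimpleGraph W) (S : Set W) : Set (W ⊕ Γ.edgeSet) :=
  Sum.inl '' S ∪ Sum.inr '' {e | ∀ p ∈ e.val, p ∈ S}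

@[simp]
lemma inl_mem_subdivisionPart {S : Set W} {p : W} :
    Sum.inl p ∈ subdivisionPart Γ S ↔ p ∈ S := by
  simp [subdivisionPart]

@[simp]
lemma inr_mem_subdivisionPart {S : Set W} {e : Γ.edgeSet} :
    Sum.inr e ∈ subdivisionPart Γ S ↔ ∀ p ∈ e.val, p ∈ S := by
  simp [subdivisionPart]

lemma Splits.exists_incident {S : Set W} {A : Set (W ⊕ Γ.edgeSet)}
    (hA : Splits A (subdivisionPart Γ S)) (hS : (Γ.induce S).Preconnected) :
    ∃ p : W, ∃ e : Γ.edgeSet, p ∈ e.val ∧ Sum.inr e ∈ subdivisionPart Γ S ∧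
      (Sum.inl p ∈ A ∧ Sum.inr e ∉ A ∨ Sum.inr e ∈ A ∧ Sum.inl p ∉ A) := by
  by_contra! hcon
  have incident {p : W} {e : Γ.edgeSet} (hp : p ∈ e.val) (he : ∀ q ∈ e.val, q ∈ S) :
      (Sum.inl p ∈ A ↔ Sum.inr e ∈ A) := by
    have := hcon p e hp (inr_mem_subdivisionPart.2 he)
    tauto
  have vertices {p q : S} (hpq : (Γ.induce S).Reachable p q) :
      (Sum.inl p.1 ∈ A ↔ Sum.inl q.1 ∈ A) := by
    obtain ⟨walk⟩ := hpq
    induction walk with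
    | nil => rfl
    | @cons p q _ hpq _ ih =>
      have he : ∀ r ∈ s(p.1, q.1), r ∈ S := by simp
      rw [← ih, incident (e := ⟨s(p.1, q.1), hpq⟩) (Sym2.mem_mk_left _ _) he,
        incident (e := ⟨s(p.1, q.1), hpq⟩) (Sym2.mem_mk_right _ _) he]
  have vertex_of {v : W ⊕ Γ.edgeSet} (hv : v ∈ subdivisionPart Γ S) :
      ∃ p : S, (v ∈ A ↔ Sum.inl p.1 ∈ A) := by
    rcases v with p | e
    · exact ⟨⟨p, inl_mem_subdivisionPart.1 hv⟩, Iff.rfl⟩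
    · rw [inr_mem_subdivisionPart] at hv
      exact ⟨⟨_, hv _ e.val.out_fst_mem⟩, (incident e.val.out_fst_mem hv).symm⟩
  obtain ⟨⟨v, hvS, hvA⟩, ⟨w, hwS, hwA⟩⟩ := hA
  obtain ⟨p, hp⟩ := vertex_of hvS
  obtain ⟨q, hq⟩ := vertex_of hwS
  exact hwA (hq.2 ((vertices (hS p q)).1 (hp.1 hvA)))

lemma not_subdivisionPart_subset_singleton {S : Set W} (hS : S.Nontrivial) (v : W ⊕ Γ.edgeSet) :
    ¬ subdivisionPart Γ S ⊆ {v} := by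
  obtain ⟨p, hp, q, hq, hpq⟩ := hS
  intro hv
  have hpv : Sum.inl p = v := hv (by simpa)
  have hqv : Sum.inl q = v := hv (by simpa)
  exact hpq (Sum.inl_injective (hpv.trans hqv.symm))

lemma splits_subdivisionPart_of_inter_nonempty {A : Set (W ⊕ Γ.edgeSet)} {S T U : Set W}
    (hS : subdivisionPart Γ S ⊆ A) (hT : Disjoint (subdivisionPart Γ T) A)
    (hSU : (S ∩ U).Nonempty) (hTU : (T ∩ U).Nonempty) : Splits A (subdivisionPart Γ U) := by
  obtain ⟨p, hpS, hpU⟩ := hSU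
  obtain ⟨q, hqT, hqU⟩ := hTU
  exact ⟨⟨.inl p, by simpa, hS (by simpa)⟩, ⟨.inl q, by simpa, Set.disjoint_left.1 hT (by simpa)⟩⟩

lemma nontrivial_of_inter_nonempty {κ : Type*} [Nontrivial κ] {S : Set W} {T : κ → Set W}
    (hT : Pairwise (Function.onFun Disjoint T)) (hST : ∀ j, (S ∩ T j).Nonempty) :
    S.Nontrivial := by
  obtain ⟨j, j', hj⟩ := exists_pair_ne κ
  obtain ⟨p, hp, hpj⟩ := hST j
  obtain ⟨q, hq, hqj⟩ := hST j'
  refine ⟨p, hp, q, hq, ?_⟩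
  rintro rfl
  exact Set.disjoint_left.1 (hT hj) hpj hqj

lemma OuterTypesLE.ncard_splits_le {H : SimpleGraph (W ⊕ Γ.edgeSet)} {A : Set (W ⊕ Γ.edgeSet)}
    {k : ℕ} (hA : OuterTypesLE H A k) (hH : ∀ p e, H.Adj (.inl p) (.inr e) ↔ p ∈ e.val)
    {ι : Type*} [Finite ι] {S : ι → Set W} (hconn : ∀ i, (Γ.induce (S i)).Preconnected)
    (hdisj : Pairwise (Function.onFun Disjoint S)) :
    {i | Splits A (subdivisionPart Γ (S i))}.ncard ≤ 2 * k := by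
  have index_eq {p : W} {e f : Γ.edgeSet} {i j : ι} (hpe : p ∈ e.val) (hpf : p ∈ f.val)
      (he : Sum.inr e ∈ subdivisionPart Γ (S i)) (hf : Sum.inr f ∈ subdivisionPart Γ (S j)) :
      i = j := by
    by_contra hij
    rw [inr_mem_subdivisionPart] at he hf
    exact Set.disjoint_left.1 (hdisj hij) (he p hpe) (hf p hpf)
  let I₁ : Set ι := {i | ∃ p : W, ∃ e : Γ.edgeSet, p ∈ e.val ∧
    Sum.inr e ∈ subdivisionPart Γ (S i) ∧ Sum.inl p ∈ A ∧ Sum.inr e ∉ A}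
  let I₂ : Set ι := {i | ∃ p : W, ∃ e : Γ.edgeSet, p ∈ e.val ∧
    Sum.inr e ∈ subdivisionPart Γ (S i) ∧ Sum.inr e ∈ A ∧ Sum.inl p ∉ A}
  have h₁ : I₁.ncard ≤ k := by
    choose p e hpe he hpA heA using fun i : I₁ => i.2
    exact hA.card_le_of_induced_matching hpA heA (fun i => (hH _ _).2 (hpe i)) fun i j hij =>
      Subtype.ext (index_eq (hpe i) ((hH _ _).1 hij) (he i) (he j))
  have h₂ : I₂.ncard ≤ k := by
    choose p e hpe he heA hpA using fun i : I₂ => i.2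
    exact hA.card_le_of_induced_matching heA hpA (fun i => ((hH _ _).2 (hpe i)).symm)
      fun i j hij => Subtype.ext (index_eq ((hH _ _).1 hij.symm) (hpe j) (he i) (he j))
  have hsub : {i | Splits A (subdivisionPart Γ (S i))} ⊆ I₁ ∪ I₂ := fun i hi => by
    obtain ⟨p, e, hpe, he, h⟩ := hi.exists_incident (hconn i)
    exact h.imp (fun h => ⟨p, e, hpe, he, h⟩) fun h => ⟨p, e, hpe, he, h⟩
  calc _ ≤ (I₁ ∪ I₂).ncard := Set.ncard_le_ncard hsub
    _ ≤ I₁.ncard + I₂.ncard := Set.ncard_union_le _ _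
    _ ≤ 2 * k := by omega

end Grid

theorem Constructible.card_le_of_grid {W : Type} {Γ : SimpleGraph W}
    {H : SimpleGraph (W ⊕ Γ.edgeSet)} {k : ℕ} (hk : Constructible H k)
    (hH : ∀ p e, H.Adj (.inl p) (.inr e) ↔ p ∈ e.val)
    {ι κ : Type*} [Finite ι] {row : ι → Set W} {col : κ → Set W}
    (hrow : ∀ i, (Γ.induce (row i)).Preconnected) (hcol : ∀ j, (Γ.induce (col j)).Preconnected)
    (hrows : Pairwise (Function.onFun Disjoint row))
    (hcols : Pairwise (Function.onFun Disjoint col))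
    (hmeet : ∀ i j, (row i ∩ col j).Nonempty) (hκ : 2 * k < Nat.card κ) :
    Nat.card ι ≤ 4 * k := by
  rcases isEmpty_or_nonempty ι with _ | ⟨⟨i⟩⟩
  · simp
  have : Finite κ := Nat.finite_of_card_ne_zero (by omega)
  have : Nonempty κ := (Nat.card_pos_iff.1 (by omega)).1
  have : Nonempty W := ⟨(hmeet i (Classical.arbitrary κ)).some⟩
  have hkpos := hk.pos
  have : Nontrivial κ := Finite.one_lt_card_iff_nontrivial.1 (by omega)
  obtain ⟨A, B, hA, hAB, ⟨i₀, hi₀⟩, hnA, hnB⟩ :=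
    hk.exists_outerTypesLE_union (Q := fun A => ∃ i, subdivisionPart Γ (row i) ⊆ A)
      (fun v ⟨i, hi⟩ =>
        not_subdivisionPart_subset_singleton (nontrivial_of_inter_nonempty hcols (hmeet i)) v hi)
      ⟨i, Set.subset_univ _⟩
  have hsplit (i : ι) : Splits A (subdivisionPart Γ (row i)) ∨
      Splits (A ∪ B) (subdivisionPart Γ (row i)) := by
    by_contra! hcon
    have hdisj := disjoint_union_of_not_splits hcon.1 hcon.2 (not_exists.1 hnA i)
      (not_exists.1 hnB i)
    have hall : {j | Splits (A ∪ B) (subdivisionPart Γ (col j))} = Set.univ :=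
      Set.eq_univ_of_forall fun j =>
        splits_subdivisionPart_of_inter_nonempty hi₀ hdisj (hmeet i₀ j) (hmeet i j)
    have hle := hAB.ncard_splits_le hH hcol hcols
    rw [hall, Set.ncard_univ] at hle
    omega
  calc Nat.card ι = ({i | Splits A (subdivisionPart Γ (row i))} ∪
        {i | Splits (A ∪ B) (subdivisionPart Γ (row i))}).ncard := by
        rw [← Set.ncard_univ, ← Set.eq_univ_of_forall hsplit]; rfl
    _ ≤ 2 * k + 2 * k := (Set.ncard_union_le _ _).trans
        (add_le_add (hA.ncard_splits_le hH hrow hrows) (hAB.ncard_splits_le hH hrow hrows))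
    _ = 4 * k := by omega

/-! ### Walls -/

lemma preconnected_of_forall_exists_adj_lt {V : Type*} {G : SimpleGraph V} (o : V) (μ : V → ℕ)
    (hμ : ∀ v, v ≠ o → ∃ w, G.Adj v w ∧ μ w < μ v) : G.Preconnected := by
  suffices hroot : ∀ v, G.Reachable v o from fun v w => (hroot v).trans (hroot w).symm
  intro v
  induction hn : μ v using Nat.strong_induction_on generalizing v with
  | _ n ih =>
    by_cases hv : v = o
    · rw [hv]
    · obtain ⟨w, hvw, hlt⟩ := hμ v hv
      exact hvw.reachable.trans (ih _ (hn ▸ hlt) w rfl)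

section Wall

variable {h : ℕ}

lemma WallVert.ext_iff {p q : WallVert h} : p = q ↔ p.x = q.x ∧ p.y = q.y :=
  ⟨fun hpq => hpq ▸ ⟨rfl, rfl⟩, fun ⟨hx, hy⟩ => Subtype.ext (Prod.ext (Fin.ext hx) (Fin.ext hy))⟩

lemma WallVert.x_lt (p : WallVert h) : p.x < 2 * h + 2 := p.1.1.2

lemma WallVert.y_lt (p : WallVert h) : p.y < h + 1 := p.1.2.2

lemma wall_adj {p q : WallVert h} : (wall h).Adj p q ↔
    (p.y = q.y ∧ (q.x = p.x + 1 ∨ p.x = q.x + 1)) ∨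
    (p.x = q.x ∧ ((q.y = p.y + 1 ∧ Odd (p.x + p.y)) ∨ (p.y = q.y + 1 ∧ Odd (q.x + q.y)))) := by
  simp only [wall, fromRel_adj, ne_eq, WallVert.ext_iff]
  grind

/-- The point `(x, y)` of a wall; the last hypothesis keeps away from the two missing corners. -/
def wallPt (x y : ℕ) (hx : x < 2 * h + 2) (hy : y < h + 1)
    (hxy : 0 < y ∧ y < h ∨ 0 < x ∧ x < 2 * h + 1) : WallVert h :=
  ⟨(⟨x, hx⟩, ⟨y, hy⟩), by
    constructor
    · simp only [not_and]; omega
    · simp only [not_and]; split_ifs <;> omega⟩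

@[simp]
lemma wallPt_x {x y : ℕ} (hx hy hxy) : (wallPt (h := h) x y hx hy hxy).x = x := rfl

@[simp]
lemma wallPt_y {x y : ℕ} (hx hy hxy) : (wallPt (h := h) x y hx hy hxy).y = y := rfl

lemma preconnected_wall_row {r : ℕ} (hr : r ∈ Set.Ioo 0 h) :
    ((wall h).induce {p | p.y = r}).Preconnected := by
  obtain ⟨hr0, hrh⟩ := hr
  refine preconnected_of_forall_exists_adj_lt
    ⟨wallPt 0 r (by omega) (by omega) (by omega), wallPt_y ..⟩ (fun p => p.1.x) ?_
  rintro ⟨p, hp⟩ hne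
  have hx := p.x_lt
  simp only [Set.mem_ofPred_eq] at hp
  simp only [ne_eq, Subtype.mk.injEq, WallVert.ext_iff, wallPt_x, wallPt_y] at hne
  refine ⟨⟨wallPt (p.x - 1) r (by omega) (by omega) (by omega), wallPt_y ..⟩, ?_, ?_⟩
  · simp only [comap_adj, Function.Embedding.subtype_apply, wall_adj, wallPt_x, wallPt_y]
    omega
  · simp only [wallPt_x]
    omega

/-- The points with `x = 2 * i` or `x = 2 * i + 1` form a zigzag path along which
`2 * y + (x + y) % 2` increases. -/
lemma preconnected_wall_column {i : ℕ} (hi : i ∈ Set.Ioo 0 h) :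
    ((wall h).induce {p | p.x / 2 = i}).Preconnected := by
  obtain ⟨hi0, hih⟩ := hi
  refine preconnected_of_forall_exists_adj_lt
    ⟨wallPt (2 * i) 0 (by omega) (by omega) (by omega), by simp⟩
    (fun p => 2 * p.1.y + (p.1.x + p.1.y) % 2) ?_
  rintro ⟨p, hp⟩ hne
  have hy := p.y_lt
  simp only [Set.mem_ofPred_eq] at hp
  simp only [ne_eq, Subtype.mk.injEq, WallVert.ext_iff, wallPt_x, wallPt_y] at hne
  by_cases hparity : (p.x + p.y) % 2 = 0
  · refine ⟨⟨wallPt p.x (p.y - 1) (by omega) (by omega) (by omega), by simpa⟩, ?_, ?_⟩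
    · simp only [comap_adj, Function.Embedding.subtype_apply, wall_adj, wallPt_x, wallPt_y,
        Nat.odd_iff, true_and]
      omega
    · simp only [wallPt_x, wallPt_y]
      omega
  · refine ⟨⟨wallPt (4 * i + 1 - p.x) p.y (by omega) (by omega) (by omega), by
      simp only [Set.mem_ofPred_eq, wallPt_x]; omega⟩, ?_, ?_⟩
    · simp only [comap_adj, Function.Embedding.subtype_apply, wall_adj, wallPt_x, wallPt_y,
        true_and]
      omega
    · simp only [wallPt_x, wallPt_y]
      omega

end Wall

/-! ### Subdivisions with cliques -/

section CliqueSubdivision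

variable {W κ : Type*}

/-- The 1-subdivision of `Γ` in which the vertices of `Γ` are made into a clique, and so are the
subdivision vertices of the edges of each colour of `χ`. -/
def cliqueSubdivision (Γ : SimpleGraph W) (χ : Γ.edgeSet → κ) :
    SimpleGraph (W ⊕ Γ.edgeSet) where
  Adj
    | .inl p, .inl q => p ≠ q
    | .inl p, .inr e => p ∈ e.val
    | .inr e, .inl p => p ∈ e.val
    | .inr e, .inr f => e ≠ f ∧ χ e = χ f
  symm := ⟨by rintro (p | e) (q | f) <;> simp [eq_comm]⟩
  loopless := ⟨by rintro (p | e) <;> simp⟩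

variable {Γ : SimpleGraph W} {χ : Γ.edgeSet → κ} {p q : W} {e f : Γ.edgeSet}

@[simp]
lemma cliqueSubdivision_adj_inl_inl :
    (cliqueSubdivision Γ χ).Adj (.inl p) (.inl q) ↔ p ≠ q := Iff.rfl

@[simp]
lemma cliqueSubdivision_adj_inl_inr :
    (cliqueSubdivision Γ χ).Adj (.inl p) (.inr e) ↔ p ∈ e.val := Iff.rfl

@[simp]
lemma cliqueSubdivision_adj_inr_inl :
    (cliqueSubdivision Γ χ).Adj (.inr e) (.inl p) ↔ p ∈ e.val := Iff.rfl

@[simp]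
lemma cliqueSubdivision_adj_inr_inr :
    (cliqueSubdivision Γ χ).Adj (.inr e) (.inr f) ↔ e ≠ f ∧ χ e = χ f := Iff.rfl

end CliqueSubdivision

section Wall

variable {h : ℕ}

lemma wall_edge_horizontal_iff {e : (wall h).edgeSet} :
    (∀ p ∈ e.val, ∀ q ∈ e.val, p.y = q.y) ↔ ¬ ∀ p ∈ e.val, ∀ q ∈ e.val, p.x = q.x := by
  obtain ⟨⟨p, q⟩, hpq⟩ := e
  have hadj := wall_adj.1 hpq
  simp only [Sym2.mem_iff]
  grind

open Classical in
/-- The direction of an edge of a wall: `true` for vertical and `false` for horizontal edges. -/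
noncomputable def wallDirection (e : (wall h).edgeSet) : Bool :=
  ∀ p ∈ e.val, ∀ q ∈ e.val, p.x = q.x

lemma complementedWall_graph :
    (complementedWall h).graph = cliqueSubdivision (wall h) wallDirection := by
  have hV₂ (e : (wall h).edgeSet) : Sum.inr e ∈ wallV2 h ↔ wallDirection e = true := by
    simp [wallV2, wallDirection]
  have hV₃ (e : (wall h).edgeSet) : Sum.inr e ∈ wallV3 h ↔ wallDirection e = false := by
    simp [wallV3, wallDirection, wall_edge_horizontal_iff]
  have hV₁ (p : WallVert h) : Sum.inl p ∈ wallV1 h := ⟨p, rfl⟩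
  have hV₁' (e : (wall h).edgeSet) : Sum.inr e ∉ wallV1 h := by simp [wallV1]
  have hV₂' (p : WallVert h) : Sum.inl p ∉ wallV2 h := by simp [wallV2]
  have hV₃' (p : WallVert h) : Sum.inl p ∉ wallV3 h := by simp [wallV3]
  have hincident (p : WallVert h) (e : (wall h).edgeSet) :
      (complementedWall h).graph.Adj (.inl p) (.inr e) ↔ p ∈ e.val := by
    simp [complementedWall, complementOn, subdivide, hV₁', hV₂', hV₃']
  ext (p | e) (q | f)
  · simp [complementedWall, complementOn, subdivide, hV₁, hV₂', hV₃']
  · exact hincident p f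
  · exact (adj_comm _ _ _).trans (hincident q e)
  · simp only [complementedWall, complementOn, hV₁', hV₂, hV₃, cliqueSubdivision_adj_inr_inr]
    simp only [subdivide, fromRel_adj, reduceCtorEq, false_and, and_false,
      exists_false, or_self, not_false_eq_true, and_true, ne_eq, Sum.inr.injEq]
    cases wallDirection e <;> cases wallDirection f <;> simp

theorem le_of_constructible_complementedWall {k : ℕ}
    (hk : Constructible (complementedWall h).graph k) : h ≤ 4 * k + 1 := by
  by_contra! hlt
  rw [complementedWall_graph] at hk
  have hgrid := hk.card_le_of_grid (fun _ _ => cliqueSubdivision_adj_inl_inr)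
    (row := fun r : Set.Ioo 0 h => {p | p.y = r})
    (col := fun i : Set.Ioo 0 h => {p | p.x / 2 = i})
    (fun r => preconnected_wall_row r.2) (fun i => preconnected_wall_column i.2)
    (fun r s hrs => Set.disjoint_left.2 fun p hr hs => hrs (Subtype.ext (hr.symm.trans hs)))
    (fun i j hij => Set.disjoint_left.2 fun p hi hj => hij (Subtype.ext (hi.symm.trans hj)))
    (fun ⟨r, hr, hrh⟩ ⟨i, hi, hih⟩ =>
      ⟨wallPt (2 * i) r (by omega) (by omega) (by omega), by simp⟩)
  simp only [Nat.card_eq_fintype_card, Fintype.card_ofFinset, Nat.card_Ioo] at hgrid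
  omega

theorem hasUnboundedCliqueWidth_complementedWall :
    HasUnboundedCliqueWidth {G | ∃ h : ℕ, 1 ≤ h ∧ G = complementedWall h} := by
  rintro ⟨c, hc⟩
  have hwidth := hc _ ⟨4 * c + 2, by omega, rfl⟩
  have : Finite (complementedWall (4 * c + 2)).V := (complementedWall _).finite
  have : Nonempty (complementedWall (4 * c + 2)).V :=
    ⟨.inl (wallPt 0 1 (by omega) (by omega) (by omega))⟩
  have hheight := le_of_constructible_complementedWall
    (constructible_cliqueWidth (complementedWall (4 * c + 2)).graph)
  omega

end Wall

/-! ### Clique partitions -/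

section CliquePartition

variable {V V' κ : Type*} {G : SimpleGraph V} {G' : SimpleGraph V'}

/-- The colour classes of `c` are cliques, and edges between different classes have an end in the
class of vertices coloured `none`. -/
structure IsCliquePartition (G : SimpleGraph V) (c : V → Option κ) : Prop where
  adj_of_eq : ∀ ⦃u v⦄, u ≠ v → c u = c v → G.Adj u v
  eq_of_adj : ∀ ⦃u v i j⦄, c u = some i → c v = some j → G.Adj u v → i = j

lemma IsCliquePartition.comp_embedding {c : V → Option κ} (hc : IsCliquePartition G c)
    (f : G' ↪g G) : IsCliquePartition G' (c ∘ f) :=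
  ⟨fun _ _ huv hcuv => f.map_adj_iff.1 (hc.adj_of_eq (f.injective.ne huv) hcuv),
    fun _ _ _ _ hu hv huv => hc.eq_of_adj hu hv (f.map_adj_iff.2 huv)⟩

lemma IsCliquePartition.card_le_of_embedding_bot [Finite κ] {c : V → Option κ}
    (hc : IsCliquePartition G c) {ι : Type*} (f : (⊥ : SimpleGraph ι) ↪g G) :
    Nat.card ι ≤ Nat.card κ + 1 := by
  have hinj : Function.Injective (c ∘ f) := fun i j hij => by
    by_contra hne
    exact (hc.comp_embedding f).adj_of_eq hne hij
  exact (Nat.card_le_card_of_injective _ hinj).trans Finite.card_option.le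

lemma isCliquePartition_cliqueSubdivision {Γ : SimpleGraph V} (χ : Γ.edgeSet → κ) :
    IsCliquePartition (cliqueSubdivision Γ χ) (Sum.elim (fun _ => none) fun e => some (χ e)) := by
  constructor
  · rintro (p | e) (q | f) <;> simp +contextual
  · rintro (p | e) (q | f) <;> simp +contextual

end CliquePartition

lemma IsCliquePartition.not_fourP1_isIndContained {V : Type*} {G : SimpleGraph V}
    {c : V → Option Bool} (hc : IsCliquePartition G c) : ¬ fourP1.graph.IsIndContained G := by
  rintro ⟨f⟩
  have hcard : Nat.card (Fin 4) ≤ Nat.card Bool + 1 := hc.card_le_of_embedding_bot f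
  simp at hcard

section CommonNeighbours

variable {W κ : Type*} {Γ : SimpleGraph W} {χ : Γ.edgeSet → κ}

lemma edge_eq_of_mem {e f : Γ.edgeSet} {p q : W} (hpq : p ≠ q) (hpe : p ∈ e.val) (hqe : q ∈ e.val)
    (hpf : p ∈ f.val) (hqf : q ∈ f.val) : e = f :=
  Subtype.ext (((Sym2.mem_and_mem_iff hpq).1 ⟨hpe, hqe⟩).trans
    ((Sym2.mem_and_mem_iff hpq).1 ⟨hpf, hqf⟩).symm)

lemma eq_or_eq_or_eq_of_mem_edge {e : Γ.edgeSet} {p q r : W} (hp : p ∈ e.val) (hq : q ∈ e.val)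
    (hr : r ∈ e.val) : p = q ∨ q = r ∨ p = r := by
  obtain ⟨s, hs⟩ := hp
  rw [hs, Sym2.mem_iff] at hq hr
  grind

lemma cliqueSubdivision_commonNeighbors_inr_inr_subsingleton {e f : Γ.edgeSet} (hef : e ≠ f)
    (hχ : χ e ≠ χ f) :
    ((cliqueSubdivision Γ χ).commonNeighbors (.inr e) (.inr f)).Subsingleton := by
  rintro (p | g) ⟨hep, hfp⟩ (q | g') ⟨heq, hfq⟩
  · by_contra hpq
    exact hef (edge_eq_of_mem (fun h => hpq (congrArg _ h)) hep heq hfp hfq)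
  · exact absurd (heq.2.trans hfq.2.symm) hχ
  · exact absurd (hep.2.trans hfp.2.symm) hχ
  · exact absurd (hep.2.trans hfp.2.symm) hχ

/-- A common neighbour of `inl p` and `inr e` is an end of `e` or an edge at `p` of the same colour
as `e`; there are at most two of each, and a vertex of the first and two of the second kind, or
two of the first and one of the second, are not pairwise adjacent. -/
lemma cliqueSubdivision_cliqueFreeOn_commonNeighbors_inl_inr
    (hχ : ∀ ⦃p e f g⦄, p ∈ e.val → p ∈ f.val → p ∈ g.val → χ e = χ f → χ f = χ g →
      e = f ∨ f = g ∨ e = g)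
    (p : W) (e : Γ.edgeSet) :
    (cliqueSubdivision Γ χ).CliqueFreeOn
      ((cliqueSubdivision Γ χ).commonNeighbors (.inl p) (.inr e)) 3 := by
  classical
  intro t ht htriangle
  obtain ⟨a, b, c, hab, hac, hbc, rfl⟩ := is3Clique_iff.1 htriangle
  simp only [Finset.coe_insert, Finset.coe_singleton, Set.insert_subset_iff,
    Set.singleton_subset_iff, mem_commonNeighbors] at ht
  rcases a with a | a <;> rcases b with b | b <;> rcases c with c | c <;>
    simp only [cliqueSubdivision_adj_inl_inl, cliqueSubdivision_adj_inl_inr,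
      cliqueSubdivision_adj_inr_inl, cliqueSubdivision_adj_inr_inr] at ht hab hac hbc <;>
    grind [eq_or_eq_or_eq_of_mem_edge]

theorem cliqueSubdivision_cliqueFreeOn_commonNeighbors
    (hχ : ∀ ⦃p e f g⦄, p ∈ e.val → p ∈ f.val → p ∈ g.val → χ e = χ f → χ f = χ g →
      e = f ∨ f = g ∨ e = g)
    {u v : W ⊕ Γ.edgeSet} (huv : u ≠ v) (hadj : ¬ (cliqueSubdivision Γ χ).Adj u v) :
    (cliqueSubdivision Γ χ).CliqueFreeOn ((cliqueSubdivision Γ χ).commonNeighbors u v) 3 := by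
  rcases u with p | e <;> rcases v with q | f
  · exact absurd (fun h => huv (congrArg _ h)) hadj
  · exact cliqueSubdivision_cliqueFreeOn_commonNeighbors_inl_inr hχ _ _
  · rw [commonNeighbors_symm]
    exact cliqueSubdivision_cliqueFreeOn_commonNeighbors_inl_inr hχ _ _
  · have hef : e ≠ f := fun h => huv (congrArg _ h)
    have hsub := cliqueSubdivision_commonNeighbors_inr_inr_subsingleton hef
      fun h => hadj ⟨hef, h⟩
    classical
    intro t ht htriangle
    obtain ⟨a, b, c, hab, -, -, rfl⟩ := is3Clique_iff.1 htriangle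
    exact hab.ne (hsub (ht (by simp)) (ht (by simp)))

end CommonNeighbours

lemma not_coThreeP1AddP2_isIndContained {V : Type*} {G : SimpleGraph V}
    (hG : ∀ ⦃u v⦄, u ≠ v → ¬ G.Adj u v → G.CliqueFreeOn (G.commonNeighbors u v) 3) :
    ¬ coThreeP1AddP2.graph.IsIndContained G := by
  classical
  rintro ⟨(f : ((⊥ : SimpleGraph (Fin 3)) ⊕g pathGraph 2)ᶜ ↪g G)⟩
  have hadj (i : Fin 3) (j : Fin 2) : G.Adj (f (.inr j)) (f (.inl i)) :=
    f.map_adj_iff.2 (by simp)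
  have htriangle (i j : Fin 3) (hij : i ≠ j) : G.Adj (f (.inl i)) (f (.inl j)) :=
    f.map_adj_iff.2 (by simp [hij])
  have hnot : ¬ G.Adj (f (.inr 0)) (f (.inr 1)) := by
    simp [f.map_adj_iff, pathGraph_adj]
  refine hG (f.injective.ne (by simp)) hnot
    (t := {f (.inl 0), f (.inl 1), f (.inl 2)}) ?_ ?_
  · simp [Set.insert_subset_iff, mem_commonNeighbors, hadj]
  · simp [is3Clique_triple_iff, htriangle]

lemma exists_wall_edge_eq {h : ℕ} {p : WallVert h} {e : (wall h).edgeSet} (hp : p ∈ e.val) :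
    ∃ a, e.val = s(p, a) ∧ (wall h).Adj p a ∧ (wallDirection e = true ↔ p.x = a.x) := by
  obtain ⟨a, ha⟩ := hp
  refine ⟨a, ha, (mem_edgeSet _).1 (ha ▸ e.2), ?_⟩
  simp only [wallDirection, ha, Sym2.mem_iff, decide_eq_true_eq]
  grind

lemma wall_edge_eq_or_eq_or_eq {h : ℕ} ⦃p : WallVert h⦄ ⦃e f g : (wall h).edgeSet⦄
    (he : p ∈ e.val) (hf : p ∈ f.val) (hg : p ∈ g.val)
    (hef : wallDirection e = wallDirection f) (hfg : wallDirection f = wallDirection g) :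
    e = f ∨ f = g ∨ e = g := by
  obtain ⟨a, ha, hpa, hea⟩ := exists_wall_edge_eq he
  obtain ⟨b, hb, hpb, hfb⟩ := exists_wall_edge_eq hf
  obtain ⟨c, hc, hpc, hgc⟩ := exists_wall_edge_eq hg
  rw [hef, hfg] at hea
  rw [hfg] at hfb
  simp only [Subtype.ext_iff, ha, hb, hc, Sym2.congr_right, WallVert.ext_iff]
  rw [wall_adj] at hpa hpb hpc
  grind

/-! ### Self-complementary graphs -/

section SelfComplementary

variable {V : Type*} {G : SimpleGraph V}

open Function in
lemma isoCompl_iterate_adj_iff (σ : G ≃g Gᶜ) (m : ℕ) {u v : V} (huv : u ≠ v) :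
    G.Adj (σ^[m] u) (σ^[m] v) ↔ (Even m ↔ G.Adj u v) := by
  induction m with
  | zero => simp
  | succ m ih =>
    have hne : σ^[m] u ≠ σ^[m] v := (σ.injective.iterate m).ne huv
    have hstep := σ.map_adj_iff (v := σ^[m] u) (w := σ^[m] v)
    rw [compl_adj] at hstep
    have hne' := σ.injective.ne hne
    simp only [iterate_succ_apply', Nat.even_add_one]
    tauto

lemma isoCompl_adj_iff (σ : G ≃g Gᶜ) {u v : V} (huv : u ≠ v) :
    G.Adj (σ u) (σ v) ↔ ¬ G.Adj u v := by
  simpa using isoCompl_iterate_adj_iff σ 1 huv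

open Function in
lemma four_dvd_minimalPeriod_isoCompl (σ : G ≃g Gᶜ) {x : V} (hx : σ x ≠ x) :
    4 ∣ minimalPeriod σ x := by
  have hperiod : IsPeriodicPt σ (minimalPeriod σ x) x := isPeriodicPt_minimalPeriod σ x
  have hperiod' : IsPeriodicPt σ (minimalPeriod σ x) (σ x) := hperiod.apply_iterate 1
  have heven : Even (minimalPeriod σ x) := by
    have hpair := isoCompl_iterate_adj_iff σ (minimalPeriod σ x) hx
    rw [hperiod'.eq, hperiod.eq] at hpair
    tauto
  obtain ⟨l, hl⟩ := heven
  have hswap : σ^[l] (σ^[l] x) = x := by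
    rw [← iterate_add_apply, ← hl, hperiod.eq]
  rcases Nat.eq_zero_or_pos l with rfl | hl0
  · simp [hl]
  have hne : σ^[l] x ≠ x := fun h => by
    have := IsPeriodicPt.minimalPeriod_le hl0 h
    omega
  have hpair := isoCompl_iterate_adj_iff σ l hne
  rw [hswap, adj_comm] at hpair
  have hl_even : Even l := by tauto
  obtain ⟨m, rfl⟩ := hl_even
  exact ⟨m, by omega⟩

open Function in
lemma isoCompl_iterate_four [Finite V] (σ : G ≃g Gᶜ) (hV : Nat.card V < 8) (x : V) :
    σ^[4] x = x := by
  by_cases hx : σ x = x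
  · exact IsFixedPt.iterate hx 4
  have hle : minimalPeriod σ x ≤ Nat.card V := by
    have hinj : Injective fun i : Set.Iio (minimalPeriod σ x) => σ^[i] x :=
      (iterate_injOn_Iio_minimalPeriod).injective
    simpa using Nat.card_le_card_of_injective _ hinj
  have hpos : 0 < minimalPeriod σ x :=
    minimalPeriod_pos_of_mem_periodicPts (σ.injective.mem_periodicPts x)
  have hfour : minimalPeriod σ x = 4 := by
    have := four_dvd_minimalPeriod_isoCompl σ hx
    omega
  rw [← hfour, iterate_minimalPeriod]

lemma exists_isoCompl_apply_eq (σ : G ≃g Gᶜ) (hV : Nat.card V = 5) : ∃ z, σ z = z := by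
  have : Finite V := Nat.finite_of_card_ne_zero (by omega)
  have := Fintype.ofFinite V
  have hpow : σ.toEquiv ^ 2 ^ 2 = 1 := Equiv.ext fun x => by
    rw [Equiv.Perm.one_apply, ← Equiv.Perm.iterate_eq_pow]
    exact isoCompl_iterate_four σ (by omega) x
  have : Fact (Nat.Prime 2) := ⟨Nat.prime_two⟩
  exact Equiv.Perm.exists_fixed_point_of_prime (by rw [← Nat.card_eq_fintype_card]; omega) hpow

lemma nonempty_iso_of_adj_iff {U : Type*} {H : SimpleGraph U} [Finite V] (f : U → V)
    (hadj : ∀ i j, G.Adj (f i) (f j) ↔ H.Adj i j)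
    (htwin : ∀ i j, i ≠ j → ∃ k, ¬ (H.Adj i k ↔ H.Adj j k))
    (hcard : Nat.card V ≤ Nat.card U) : Nonempty (G ≃g H) := by
  have hinj : Function.Injective f := fun i j hij => by
    by_contra hne
    obtain ⟨k, hk⟩ := htwin i j hne
    exact hk (by rw [← hadj, ← hadj, hij])
  exact ⟨RelIso.symm ⟨Equiv.ofBijective f (hinj.bijective_of_nat_card_le hcard), hadj _ _⟩⟩

lemma nonempty_iso_bull_of_adj {a b c d e : V} (hV : Nat.card V = 5)
    (hab : G.Adj a b) (hbc : G.Adj b c) (hcd : G.Adj c d) (hde : G.Adj d e) (hbd : G.Adj b d)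
    (hac : ¬ G.Adj a c) (had : ¬ G.Adj a d) (hae : ¬ G.Adj a e) (hbe : ¬ G.Adj b e)
    (hce : ¬ G.Adj c e) : Nonempty (G ≃g bull) := by
  have : Finite V := Nat.finite_of_card_ne_zero (by omega)
  refine nonempty_iso_of_adj_iff ![a, b, c, d, e] ?_ (by
    simp only [bull, fromEdgeSet_adj, Set.mem_insert_iff, Set.mem_singleton_iff]
    decide) (by simp [hV])
  simp [Fin.forall_fin_succ, bull, G.adj_comm, *]

lemma nonempty_iso_cycleGraph_five_of_adj {a b c d e : V} (hV : Nat.card V = 5)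
    (hab : G.Adj a b) (hbc : G.Adj b c) (hcd : G.Adj c d) (hde : G.Adj d e) (hae : G.Adj a e)
    (hac : ¬ G.Adj a c) (had : ¬ G.Adj a d) (hbd : ¬ G.Adj b d) (hbe : ¬ G.Adj b e)
    (hce : ¬ G.Adj c e) : Nonempty (G ≃g cycleGraph 5) := by
  have : Finite V := Nat.finite_of_card_ne_zero (by omega)
  refine nonempty_iso_of_adj_iff ![a, b, c, d, e] ?_ (by decide) (by simp [hV])
  simp +decide [Fin.forall_fin_succ, cycleGraph_adj, G.adj_comm, *]

lemma nonempty_iso_bull_or_cycleGraph_five_of_path {a b c d z : V} (hV : Nat.card V = 5)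
    (hab : G.Adj a b) (hbc : G.Adj b c) (hcd : G.Adj c d)
    (hac : ¬ G.Adj a c) (had : ¬ G.Adj a d) (hbd : ¬ G.Adj b d)
    (hzb : G.Adj z b ↔ ¬ G.Adj z a) (hzc : G.Adj z c ↔ ¬ G.Adj z a)
    (hzd : G.Adj z d ↔ G.Adj z a) :
    Nonempty (G ≃g bull) ∨ Nonempty (G ≃g cycleGraph 5) := by
  by_cases hza : G.Adj z a
  · exact .inr (nonempty_iso_cycleGraph_five_of_adj hV hab hbc hcd (hzd.2 hza).symm hza.symm hac had
      hbd (fun h => hzb.1 h.symm hza) (fun h => hzc.1 h.symm hza))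
  · exact .inl (nonempty_iso_bull_of_adj hV hab (hzb.2 hza).symm (hzc.2 hza) hcd hbc
      (fun h => hza h.symm) hac had hbd (fun h => hza (hzd.1 h)))

theorem nonempty_iso_bull_or_cycleGraph_five (σ : G ≃g Gᶜ) (hV : Nat.card V = 5) :
    Nonempty (G ≃g bull) ∨ Nonempty (G ≃g cycleGraph 5) := by
  have : Finite V := Nat.finite_of_card_ne_zero (by omega)
  obtain ⟨z, hz⟩ := exists_isoCompl_apply_eq σ hV
  have : Nontrivial V := Finite.one_lt_card_iff_nontrivial.1 (by omega)
  obtain ⟨x, hxz⟩ := exists_ne z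
  have hperiod (y : V) : σ (σ (σ (σ y))) = y := isoCompl_iterate_four σ (by omega) y
  have hadj {u v : V} (huv : u ≠ v) : G.Adj (σ u) (σ v) ↔ ¬ G.Adj u v := isoCompl_adj_iff σ huv
  have hmove {y : V} (hy : y ≠ z) : σ y ≠ z := fun h => hy (σ.injective (h.trans hz.symm))
  have hzadj {y : V} (hy : y ≠ z) : G.Adj z (σ y) ↔ ¬ G.Adj z y := by
    simpa only [hz] using hadj hy.symm
  have hne {y : V} (hy : y ≠ z) : y ≠ σ y := fun h => by
    have := hzadj hy
    rw [← h] at this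
    tauto
  wlog h₀₁ : G.Adj x (σ x) generalizing x with hwlog
  · exact hwlog (σ x) (hmove hxz) ((hadj (hne hxz)).2 h₀₁)
  have h₁₂ : ¬ G.Adj (σ x) (σ (σ x)) := by grind
  have h₂₃ : G.Adj (σ (σ x)) (σ (σ (σ x))) := by grind
  have h₀₃ : ¬ G.Adj x (σ (σ (σ x))) := by grind [G.adj_comm]
  have h₁₃ : G.Adj (σ x) (σ (σ (σ x))) ↔ ¬ G.Adj x (σ (σ x)) :=
    hadj fun h => h₁₂ (h ▸ h₀₁.symm)
  have hz₁ : G.Adj z (σ x) ↔ ¬ G.Adj z x := hzadj hxz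
  have hz₂ : G.Adj z (σ (σ x)) ↔ G.Adj z x := by grind
  have hz₃ : G.Adj z (σ (σ (σ x))) ↔ ¬ G.Adj z x := by grind
  by_cases h₀₂ : G.Adj x (σ (σ x))
  · exact nonempty_iso_bull_or_cycleGraph_five_of_path (z := z) hV h₀₁.symm h₀₂ h₂₃ h₁₂
      (fun h => h₁₃.1 h h₀₂) h₀₃ (by tauto) (by tauto) (by tauto)
  · exact nonempty_iso_bull_or_cycleGraph_five_of_path (z := z) hV h₀₁ (h₁₃.2 h₀₂) h₂₃.symm h₀₃
      h₀₂ h₁₂ hz₁ hz₃ hz₂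

variable {κ : Type*} {c : V → Option κ}

lemma even_choose_two_of_isoCompl [Finite V] (σ : G ≃g Gᶜ) : Even ((Nat.card V).choose 2) := by
  classical
  have := Fintype.ofFinite V
  refine ⟨G.edgeFinset.card, ?_⟩
  rw [Nat.card_eq_fintype_card, ← card_edgeFinset_top_eq_card_choose_two]
  have htop : (⊤ : SimpleGraph V).edgeFinset = (G ⊔ Gᶜ).edgeFinset :=
    edgeFinset_inj.2 sup_compl_eq_top.symm
  rw [htop, edgeFinset_sup,
    Finset.card_union_of_disjoint (disjoint_edgeFinset.2 disjoint_compl_right),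
    σ.card_edgeFinset_eq]

lemma IsCliquePartition.injective_isoCompl (hc : IsCliquePartition G c) (σ : G ≃g Gᶜ)
    (i : Option κ) : Function.Injective fun v : {v // c v = i} => c (σ v) := by
  rintro ⟨u, hu⟩ ⟨v, hv⟩ huv
  by_contra! hne
  have hne : u ≠ v := fun h => hne (Subtype.ext h)
  have hadj : G.Adj u v := hc.adj_of_eq hne (hu.trans hv.symm)
  exact (isoCompl_adj_iff σ hne).1 (hc.adj_of_eq (σ.injective.ne hne) huv) hadj

lemma IsCliquePartition.card_fiber_le [Finite κ] (hc : IsCliquePartition G c) (σ : G ≃g Gᶜ)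
    (i : Option κ) : Nat.card {v // c v = i} ≤ Nat.card κ + 1 :=
  (Nat.card_le_card_of_injective _ (hc.injective_isoCompl σ i)).trans Finite.card_option.le

/-- The image of the large class meets every class, so the image of a vertex `z` of the other
class, being adjacent to all of it, cannot have a colour `some k`; two such images would then be
nonadjacent vertices coloured `none`. -/
lemma IsCliquePartition.subsingleton_fiber [Finite κ] (hc : IsCliquePartition G c) (σ : G ≃g Gᶜ)
    {i j : κ} (hij : i ≠ j) (hi : Nat.card κ < Nat.card {v // c v = some i}) :
    Subsingleton {v // c v = some j} := by
  have hsurj := ((hc.injective_isoCompl σ (some i)).bijective_of_nat_card_le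
    (Finite.card_option.trans_le hi)).surjective
  refine ⟨?_⟩
  rintro ⟨x, hx⟩ ⟨y, hy⟩
  by_contra! hxy
  have hnone (z : V) (hz : c z = some j) : c (σ z) = none := by
    by_contra! hsome
    obtain ⟨k, hk⟩ := Option.ne_none_iff_exists'.1 hsome
    have : Nontrivial κ := ⟨i, j, hij⟩
    obtain ⟨l, hl⟩ := exists_ne k
    obtain ⟨⟨u, hu⟩, hul : c (σ u) = some l⟩ := hsurj (some l)
    have huz : u ≠ z := by
      rintro rfl
      exact hij (Option.some_injective _ (hu.symm.trans hz))
    have hnadj : ¬ G.Adj u z := fun h => hij (hc.eq_of_adj hu hz h)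
    exact hl (hc.eq_of_adj hul hk ((isoCompl_adj_iff σ huz).2 hnadj))
  exact hxy (hc.injective_isoCompl σ (some j) ((hnone x hx).trans (hnone y hy).symm))

lemma IsCliquePartition.card_le_seven [Finite V] {c : V → Option Bool}
    (hc : IsCliquePartition G c) (σ : G ≃g Gᶜ) : Nat.card V ≤ 7 := by
  have hsum : Nat.card V = Nat.card {v // c v = none} +
      (Nat.card {v // c v = some true} + Nat.card {v // c v = some false}) := by
    rw [← Nat.card_congr (Equiv.sigmaFiberEquiv c), Nat.card_sigma]
    simp
  have hle (i : Option Bool) : Nat.card {v // c v = i} ≤ 3 := by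
    simpa using hc.card_fiber_le σ i
  have hle_one {i j : Bool} (hij : i ≠ j) (hi : 2 < Nat.card {v // c v = some i}) :
      Nat.card {v // c v = some j} ≤ 1 :=
    Finite.card_le_one_iff_subsingleton.2 (hc.subsingleton_fiber σ hij (by simpa using hi))
  have := hle none
  have := hle (some true)
  have := hle (some false)
  have := hle_one Bool.false_ne_true
  have := hle_one Bool.false_ne_true.symm
  omega

lemma IsCliquePartition.eq_none_of_path (hc : IsCliquePartition G c) {u v w : V} (huw : u ≠ w)
    (huv : G.Adj u v) (hvw : G.Adj v w) (hnuw : ¬ G.Adj u w) :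
    c u = none ∨ c v = none ∨ c w = none := by
  by_contra! hsome
  obtain ⟨⟨i, hi⟩, ⟨j, hj⟩, ⟨k, hk⟩⟩ := hsome.imp Option.ne_none_iff_exists'.1
    (And.imp Option.ne_none_iff_exists'.1 Option.ne_none_iff_exists'.1)
  refine hnuw (hc.adj_of_eq huw ?_)
  rw [hi, hk, hc.eq_of_adj hi hj huv, hc.eq_of_adj hj hk hvw]

lemma not_isCliquePartition_cycleGraph_five (c : Fin 5 → Option κ) :
    ¬ IsCliquePartition (cycleGraph 5) c := by
  intro hc
  have hpath (i : Fin 5) : c i = none ∨ c (i + 1) = none ∨ c (i + 2) = none := by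
    apply hc.eq_none_of_path <;> decide +revert
  have hnadj (i : Fin 5) : i ≠ i + 2 ∧ ¬ (cycleGraph 5).Adj i (i + 2) := by
    decide +revert
  have hclique (i : Fin 5) (hi : c i = none) : c (i + 2) ≠ none := fun hi' =>
    (hnadj i).2 (hc.adj_of_eq (hnadj i).1 (hi.trans hi'.symm))
  have := Fin.forall_fin_succ.1 hpath
  have := Fin.forall_fin_succ.1 hclique
  grind

theorem nonempty_iso_bull_of_isCliquePartition {c : V → Option Bool}
    (hc : IsCliquePartition G c) (σ : G ≃g Gᶜ) (hV : 5 ≤ Nat.card V) :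
    Nonempty (G ≃g bull) := by
  have : Finite V := Nat.finite_of_card_ne_zero (by omega)
  have hcard : Nat.card V = 5 := by
    have hle := hc.card_le_seven σ
    have heven := even_choose_two_of_isoCompl σ
    generalize Nat.card V = n at *
    interval_cases n <;> revert heven <;> decide
  refine (nonempty_iso_bull_or_cycleGraph_five σ hcard).resolve_right fun ⟨φ⟩ => ?_
  exact not_isCliquePartition_cycleGraph_five _ (hc.comp_embedding φ.symm.toEmbedding)

end SelfComplementary

theorem complementedWall_mem_freeGraphs (h : ℕ) :
    complementedWall h ∈ freeGraphs ({fourP1, coThreeP1AddP2} ∪ selfComplementaryNonBull) := by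
  have hc := isCliquePartition_cliqueSubdivision (wallDirection (h := h))
  rw [← complementedWall_graph] at hc
  rintro H ((rfl | rfl) | ⟨⟨σ⟩, hcard, hbull⟩)
  · exact hc.not_fourP1_isIndContained
  · refine not_coThreeP1AddP2_isIndContained ?_
    rw [complementedWall_graph]
    exact fun _ _ => cliqueSubdivision_cliqueFreeOn_commonNeighbors wall_edge_eq_or_eq_or_eq
  · rintro ⟨f⟩
    obtain ⟨φ⟩ := nonempty_iso_bull_of_isCliquePartition (hc.comp_embedding f) σ hcard
    exact hbull.false φ

end CliqueWidth

theorem mainTheorem6 :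
    CliqueWidth.HasUnboundedCliqueWidth
      (CliqueWidth.freeGraphs ({CliqueWidth.fourP1, CliqueWidth.coThreeP1AddP2} ∪
        CliqueWidth.selfComplementaryNonBull)) ∧
    (∀ h : ℕ, 1 ≤ h → CliqueWidth.complementedWall h ∈
      CliqueWidth.freeGraphs ({CliqueWidth.fourP1, CliqueWidth.coThreeP1AddP2} ∪
        CliqueWidth.selfComplementaryNonBull)) ∧
    CliqueWidth.HasUnboundedCliqueWidth
      {G | ∃ h : ℕ, 1 ≤ h ∧ G = CliqueWidth.complementedWall h} := by
  refine ⟨?_, fun h _ => CliqueWidth.complementedWall_mem_freeGraphs h,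
    CliqueWidth.hasUnboundedCliqueWidth_complementedWall⟩
  rintro ⟨c, hc⟩
  refine CliqueWidth.hasUnboundedCliqueWidth_complementedWall ⟨c, ?_⟩
  rintro _ ⟨h, _, rfl⟩
  exact hc _ (CliqueWidth.complementedWall_mem_freeGraphs h)
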